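/- Let $N\ge 2$, $1<p<\infty$, and let $F:\mathbb{R}^N\to[0,+\infty[$ be a convex function with $F(t\xi)=|t|F(\xi)$ for all $t\in\mathbb{R}$, $\xi\in\mathbb{R}^N$, with $F(\xi)\ge c|\xi|$ for some constant $c>0$, of class $C^{3,\beta}$ on $\mathbb{R}^N\setminus\{0\}$ for some $\beta\in]0,1[$ (third derivatives Hölder continuous on compact subsets of $\mathbb{R}^N\setminus\{0\}$), and such that the Hessian of $F^p$ is positive definite on $\mathbb{R}^N\setminus\{0\}$. Let $F^o(v)=\sup_{\xi\neq 0}\frac{\langle \xi,v\rangle}{F(\xi)}$ be its polar. For a nonempty bounded open set $\Omega\subset\mathbb{R}^N$ define the anisotropic inradius $$R_F(\Omega)=\sup_{x\in\Omega}\ \inf_{y\in\partial\Omega}F^o(x-y)$$ and the anisotropic Cheeger constant $$h_F(\Omega)=\inf\Big\{\frac{P_F(K)}{|K|}\colon K\subseteq\Omega \text{ measurable},\ |K|>0\Big\},$$ where $|K|$ is the Lebesgue measure and $$P_F(K)=\sup\Big\{\int_K \operatorname{div}\sigma\,dx\colon \sigma\in C^1_c(\mathbb{R}^N;\mathbb{R}^N),\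 F^o(\sigma)\le 1\Big\}\in[0,+\infty].$$ Then for every nonempty bounded open convex set $\Omega\subset\mathbb{R}^N$ one has $R_F(\Omega)>0$ and $$h_F(\Omega)\ \ge\ \frac{1}{R_F(\Omega)}.$$ Moreover the inequality is optimal, equality being attained asymptotically by thin rectangles: for every coordinate direction $i\in\{1,\dots,N\}$ and every $a>0$, the rectangles $\Omega_{a,k}=\{x\in\mathbb{R}^N\colon |x_i|<a,\ |x_j|<k \text{ for } j\ne i\}$ satisfy $$\lim_{k\to+\infty} h_F(\Omega_{a,k})\,R_F(\Omega_{a,k})=1 .$$ -/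

import Mathlib

open MeasureTheory Filter Topology
open scoped NNReal ENNReal ContDiff

noncomputable section

namespace AnisotropicCheeger

/-- The Euclidean space `ℝ^N`. -/
abbrev E (N : ℕ) : Type := EuclideanSpace ℝ (Fin N)

/-- `F` is a convex, even, 1-homogeneous function on `ℝ^N`, bounded from below by a positive
multiple of the Euclidean norm, of class `C^{3,β}` on `ℝ^N ∖ {0}` for some `0 < β < 1`
(third derivatives Hölder continuous on compact subsets), and such that the Hessian of `F ^ p`
is positive definite away from the origin. -/
structure IsAdmissible {N : ℕ} (p : ℝ) (F : E N → ℝ) : Prop where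
  convexOn : ConvexOn ℝ Set.univ F
  homogeneous : ∀ (t : ℝ) (ξ : E N), F (t • ξ) = |t| * F ξ
  lower_bound : ∃ a : ℝ, 0 < a ∧ ∀ ξ : E N, a * ‖ξ‖ ≤ F ξ
  contDiffOn : ContDiffOn ℝ 3 F {0}ᶜ
  holder : ∃ β : ℝ≥0, 0 < β ∧ β < 1 ∧ ∀ K : Set (E N), IsCompact K → K ⊆ {0}ᶜ →
    ∃ C : ℝ≥0, HolderOnWith C β (iteratedFDeriv ℝ 3 F) K
  hessian_pos : ∀ ξ : E N, ξ ≠ 0 → ∀ v : E N, v ≠ 0 →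
    0 < iteratedFDeriv ℝ 2 (fun η : E N => F η ^ p) ξ ![v, v]

/-- The polar function `F°(v) = sup_{ξ ≠ 0} ⟨ξ, v⟩ / F(ξ)`. -/
def polar {N : ℕ} (F : E N → ℝ) (v : E N) : ℝ :=
  ⨆ ξ : {ξ : E N // ξ ≠ 0}, inner ℝ ξ.1 v / F ξ.1

/-- The anisotropic distance to the boundary, `d_F(x) = inf_{y ∈ ∂Ω} F°(x - y)`. -/
def distBoundary {N : ℕ} (F : E N → ℝ) (Ω : Set (E N)) (x : E N) : ℝ :=
  ⨅ y : frontier Ω, polar F (x - y.1)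

/-- The anisotropic inradius `R_F(Ω) = sup_{x ∈ Ω} d_F(x)`. -/
def inradius {N : ℕ} (F : E N → ℝ) (Ω : Set (E N)) : ℝ :=
  ⨆ x : Ω, distBoundary F Ω x.1

/-- The divergence of a vector field. -/
def divergence {N : ℕ} (σ : E N → E N) (x : E N) : ℝ :=
  ∑ i : Fin N, fderiv ℝ σ x (EuclideanSpace.single i 1) i

/-- The anisotropic perimeter
`P_F(K) = sup {∫_K div σ : σ ∈ C¹_c(ℝ^N; ℝ^N), F°(σ) ≤ 1}`, possibly `∞`. The supremum is not
affected by truncating the integrals at `0`, as `σ = 0` is allowed. -/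
def perimeter {N : ℕ} (F : E N → ℝ) (K : Set (E N)) : ℝ≥0∞ :=
  ⨆ (σ : E N → E N) (_ : ContDiff ℝ 1 σ) (_ : HasCompactSupport σ) (_ : ∀ x, polar F (σ x) ≤ 1),
    ENNReal.ofReal (∫ x in K, divergence σ x)

/-- The anisotropic Cheeger constant `h_F(Ω) = inf_{K ⊆ Ω} P_F(K) / |K|`, over the measurable
subsets of positive Lebesgue measure. -/
def cheegerConstant {N : ℕ} (F : E N → ℝ) (Ω : Set (E N)) : ℝ≥0∞ :=
  ⨅ (K : Set (E N)) (_ : MeasurableSet K) (_ : K ⊆ Ω) (_ : 0 < volume K),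
    perimeter F K / volume K

/-- The `N`-rectangle with half-side `a` in the `i`-th coordinate direction and half-side `k`
in all the other ones. -/
def rectangle {N : ℕ} (i : Fin N) (a k : ℝ) : Set (E N) :=
  {x | |x i| < a ∧ ∀ j, j ≠ i → |x j| < k}

end AnisotropicCheeger

end

namespace AnisotropicCheeger

/-! ### The norm `F` and its polar -/

section Norm

variable {N : ℕ} {p : ℝ} {F : E N → ℝ}

/-! The lower bound is a calibration argument. Let `d` be the anisotropic distance to the boundary
of a convex `Ω`, and `R` its supremum. Then `d` is concave, `F (∇d) = 1` almost everywhere, and `0 ≤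
d ≤ R`. The field `σ = R⁻¹ (d - R) ∇F(∇d)` has `F°(σ) ≤ 1`. By Euler's identity and since `div
∇F(∇d) ≤ 0`, formally `div σ ≥ 1 / R`, so that `P_F(K) ≥ |K| / R` for every `K ⊆ Ω`.

To obtain an admissible `C¹` field, `d` is replaced by the minimum of finitely many affine functions
`c - ⟨ν, x⟩` with `F ν = 1`, nonnegative on `Ω`; supporting half-spaces and compactness keep it
below `R + η` (`exists_supporting_lt`). The minimum is smoothed to a log-sum-exp `softMin`, with
gradient minus a Gibbs mean, and `∇F` is cut off near its singularity at `0` into the monotone field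
`regGrad`. The derivative of the Gibbs mean is a covariance, so the sign of the divergence survives
(`divergence_regGrad_gibbsMean_nonpos`). The loss due to the cutoff disappears as `b → ∞`
(`tendsto_integral_cutoff`), which gives `le_perimeter`.

For optimality the rectangle itself is the competitor. The divergence theorem bounds its Cheeger
quotient by `∑ F(e_j) / r_j`, which tends to `F(e_i) / a`, while its inradius is at most `a /
F(e_i)`. -/

lemma IsAdmissible.map_zero (hF : IsAdmissible p F) : F 0 = 0 := by
  simpa using hF.homogeneous 0 0

lemma IsAdmissible.map_neg (hF : IsAdmissible p F) (ξ : E N) : F (-ξ) = F ξ := by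
  simpa using hF.homogeneous (-1) ξ

lemma IsAdmissible.pos (hF : IsAdmissible p F) {ξ : E N} (hξ : ξ ≠ 0) : 0 < F ξ := by
  obtain ⟨a, ha, h⟩ := hF.lower_bound
  exact lt_of_lt_of_le (mul_pos ha (norm_pos_iff.2 hξ)) (h ξ)

lemma IsAdmissible.nonneg (hF : IsAdmissible p F) (ξ : E N) : 0 ≤ F ξ := by
  obtain ⟨a, ha, h⟩ := hF.lower_bound
  exact le_trans (by positivity) (h ξ)

lemma IsAdmissible.add_le (hF : IsAdmissible p F) (ξ η : E N) : F (ξ + η) ≤ F ξ + F η := by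
  have h := hF.convexOn.2 (Set.mem_univ ((2 : ℝ) • ξ)) (Set.mem_univ ((2 : ℝ) • η))
    (show (0 : ℝ) ≤ 1 / 2 by norm_num) (show (0 : ℝ) ≤ 1 / 2 by norm_num) (by norm_num)
  rw [hF.homogeneous, hF.homogeneous, smul_smul, smul_smul] at h
  norm_num at h
  linarith

lemma IsAdmissible.continuous (hF : IsAdmissible p F) : Continuous F :=
  continuousOn_univ.1 (hF.convexOn.continuousOn isOpen_univ)

lemma IsAdmissible.upper_bound (hF : IsAdmissible p F) :
    ∃ M : ℝ, 0 < M ∧ ∀ ξ : E N, F ξ ≤ M * ‖ξ‖ := by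
  obtain ⟨M, hM⟩ := (isCompact_sphere (0 : E N) 1).exists_bound_of_continuousOn
    hF.continuous.continuousOn
  refine ⟨max M 1, by positivity, fun ξ => ?_⟩
  rcases eq_or_ne ξ 0 with rfl | hξ
  · simp [hF.map_zero]
  · have hn : 0 < ‖ξ‖ := norm_pos_iff.2 hξ
    have h1 := hM (‖ξ‖⁻¹ • ξ) (by simp [norm_smul, hn.ne'])
    rw [hF.homogeneous, abs_of_pos (inv_pos.2 hn), Real.norm_eq_abs] at h1
    have h2 : ‖ξ‖⁻¹ * F ξ ≤ max M 1 := (le_abs_self _).trans (h1.trans (le_max_left _ _))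
    rwa [inv_mul_le_iff₀ hn, mul_comm] at h2

lemma polar_le (F : E N → ℝ) {v : E N} {c : ℝ} (hc : 0 ≤ c)
    (h : ∀ ξ, ξ ≠ 0 → inner ℝ ξ v / F ξ ≤ c) : polar F v ≤ c :=
  Real.iSup_le (fun ξ => h ξ.1 ξ.2) hc

lemma IsAdmissible.polar_bddAbove (hF : IsAdmissible p F) (v : E N) :
    BddAbove (Set.range fun ξ : {ξ : E N // ξ ≠ 0} => inner ℝ ξ.1 v / F ξ.1) := by
  obtain ⟨a, ha, h⟩ := hF.lower_bound
  refine ⟨‖v‖ / a, ?_⟩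
  rintro _ ⟨⟨ξ, hξ⟩, rfl⟩
  rw [div_le_div_iff₀ (hF.pos hξ) ha]
  calc inner ℝ ξ v * a ≤ ‖ξ‖ * ‖v‖ * a := by gcongr; exact real_inner_le_norm _ _
    _ = ‖v‖ * (a * ‖ξ‖) := by ring
    _ ≤ ‖v‖ * F ξ := by gcongr; exact h ξ

lemma IsAdmissible.inner_le_mul_polar (hF : IsAdmissible p F) (ξ v : E N) :
    inner ℝ ξ v ≤ F ξ * polar F v := by
  rcases eq_or_ne ξ 0 with rfl | hξ
  · simp [hF.map_zero]
  · have := le_ciSup (hF.polar_bddAbove v) ⟨ξ, hξ⟩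
    rw [div_le_iff₀ (hF.pos hξ)] at this
    rwa [mul_comm]

/-- Since `F` is even, the one-sided bound on `⟨ξ, v⟩` is two-sided, so the sign of `t` is
irrelevant. The calibrating field has a nonpositive scalar factor on `Ω`. -/
lemma IsAdmissible.polar_smul_le (hF : IsAdmissible p F) {c t : ℝ} {v : E N}
    (hc : 0 ≤ c) (hv : ∀ ξ, inner ℝ ξ v ≤ c * F ξ) : polar F (t • v) ≤ |t| * c := by
  refine polar_le F (by positivity) fun ξ hξ => ?_
  rw [div_le_iff₀ (hF.pos hξ), inner_smul_right]
  have h1 := hv ξ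
  have h2 := hv (-ξ)
  rw [inner_neg_left, hF.map_neg] at h2
  calc t * inner ℝ ξ v ≤ |t * inner ℝ ξ v| := le_abs_self _
    _ = |t| * |inner ℝ ξ v| := abs_mul _ _
    _ ≤ |t| * (c * F ξ) := by gcongr; exact abs_le.2 ⟨by linarith, h1⟩
    _ = _ := by ring

lemma IsAdmissible.polar_nonneg (hF : IsAdmissible p F) (v : E N) : 0 ≤ polar F v := by
  rcases eq_or_ne v 0 with rfl | hv
  · exact Real.iSup_nonneg fun ξ => by simp
  · exact Real.iSup_nonneg' ⟨⟨v, hv⟩, div_nonneg real_inner_self_nonneg (hF.nonneg v)⟩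

lemma IsAdmissible.exists_polar_le (hF : IsAdmissible p F) :
    ∃ C : ℝ, 0 < C ∧ ∀ v : E N, polar F v ≤ C * ‖v‖ := by
  obtain ⟨a, ha, h⟩ := hF.lower_bound
  refine ⟨a⁻¹, inv_pos.2 ha, fun v => polar_le F (by positivity) fun ξ hξ => ?_⟩
  rw [div_le_iff₀ (hF.pos hξ)]
  calc inner ℝ ξ v ≤ ‖ξ‖ * ‖v‖ := real_inner_le_norm _ _
    _ = a⁻¹ * ‖v‖ * (a * ‖ξ‖) := by field_simp
    _ ≤ _ := by gcongr; exact h ξ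

lemma IsAdmissible.exists_le_polar (hF : IsAdmissible p F) :
    ∃ c : ℝ, 0 < c ∧ ∀ v : E N, c * ‖v‖ ≤ polar F v := by
  obtain ⟨M, hM, h⟩ := hF.upper_bound
  refine ⟨M⁻¹, inv_pos.2 hM, fun v => ?_⟩
  rcases eq_or_ne v 0 with rfl | hv
  · simpa using hF.polar_nonneg 0
  · have h1 := hF.inner_le_mul_polar v v
    rw [real_inner_self_eq_norm_sq] at h1
    have hn : 0 < ‖v‖ := norm_pos_iff.2 hv
    have h2 : ‖v‖ ^ 2 ≤ M * ‖v‖ * polar F v :=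
      h1.trans (mul_le_mul_of_nonneg_right (h v) (hF.polar_nonneg v))
    rw [inv_mul_le_iff₀ hM]
    nlinarith

end Norm

/-! ### The gradient of `F` and its regularization -/

section Gradient

variable {N : ℕ} {p : ℝ} {F : E N → ℝ}

/-- The gradient of `F`, in coordinates. -/
noncomputable def grad (F : E N → ℝ) (ξ : E N) : E N :=
  WithLp.toLp 2 fun i => fderiv ℝ F ξ (EuclideanSpace.single i 1)

lemma sum_smul_single (v : E N) : ∑ i, v i • EuclideanSpace.single i (1 : ℝ) = v := by
  ext j
  simp [Finset.sum_apply, Pi.single_apply]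

lemma inner_grad (F : E N → ℝ) (ξ v : E N) : inner ℝ v (grad F ξ) = fderiv ℝ F ξ v := by
  conv_rhs => rw [← sum_smul_single v]
  simp [grad, PiLp.inner_apply, mul_comm]

lemma IsAdmissible.differentiableAt (hF : IsAdmissible p F) {ξ : E N} (hξ : ξ ≠ 0) :
    DifferentiableAt ℝ F ξ :=
  (hF.contDiffOn.contDiffAt (isOpen_compl_singleton.mem_nhds hξ)).differentiableAt (by norm_num)

lemma IsAdmissible.contDiffAt_grad (hF : IsAdmissible p F) {ξ : E N} (hξ : ξ ≠ 0) :
    ContDiffAt ℝ 1 (grad F) ξ := by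
  refine contDiffAt_euclidean.2 fun i => ?_
  have h := (hF.contDiffOn.contDiffAt (isOpen_compl_singleton.mem_nhds hξ)).fderiv_right
    (m := 1) (by norm_num)
  exact h.clm_apply contDiffAt_const

/-- Subadditivity and homogeneity bound the difference quotients of `F` in the direction `η` by `F
η`. Hence gradients of `F` lie in the polar unit ball. -/
lemma IsAdmissible.inner_grad_le (hF : IsAdmissible p F) {ξ : E N} (hξ : ξ ≠ 0) (η : E N) :
    inner ℝ η (grad F ξ) ≤ F η := by
  rw [inner_grad]
  have hd := (hF.differentiableAt hξ).hasFDerivAt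
  have h1 : HasDerivAt (fun t : ℝ => F (ξ + t • η)) (fderiv ℝ F ξ η) 0 := by
    have h0 : HasDerivAt (fun t : ℝ => ξ + t • η) η 0 := by
      simpa using ((hasDerivAt_id (0 : ℝ)).smul_const η).const_add ξ
    have hd' : HasFDerivAt F (fderiv ℝ F ξ) (ξ + (0 : ℝ) • η) := by simpa using hd
    exact hd'.comp_hasDerivAt 0 h0
  have h2 := h1.tendsto_slope_zero_right
  refine le_of_tendsto h2 ?_
  filter_upwards [self_mem_nhdsWithin] with t ht
  have ht : 0 < t := ht
  have h3 := hF.add_le ξ (t • η)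
  rw [hF.homogeneous, abs_of_pos ht] at h3
  simp only [zero_add, zero_smul, add_zero, smul_eq_mul]
  rw [inv_mul_le_iff₀ ht]
  linarith

lemma IsAdmissible.inner_grad_self (hF : IsAdmissible p F) {ξ : E N} (hξ : ξ ≠ 0) :
    inner ℝ ξ (grad F ξ) = F ξ := by
  refine le_antisymm (hF.inner_grad_le hξ ξ) ?_
  rw [inner_grad]
  have hd := (hF.differentiableAt hξ).hasFDerivAt
  have h1 : HasDerivAt (fun t : ℝ => F (t • ξ)) (fderiv ℝ F ξ ξ) 1 := by
    have h0 : HasDerivAt (fun t : ℝ => t • ξ) ξ 1 := by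
      simpa using (hasDerivAt_id (1 : ℝ)).smul_const ξ
    have hd' : HasFDerivAt F (fderiv ℝ F ξ) ((1 : ℝ) • ξ) := by simpa using hd
    exact hd'.comp_hasDerivAt 1 h0
  have h2 : HasDerivAt (fun t : ℝ => F (t • ξ)) (F ξ) 1 := by
    have h3 : HasDerivAt (fun t : ℝ => t * F ξ) (F ξ) 1 := by
      simpa using (hasDerivAt_id (1 : ℝ)).mul_const (F ξ)
    refine h3.congr_of_eventuallyEq ?_
    filter_upwards [lt_mem_nhds (zero_lt_one (α := ℝ))] with t ht
    rw [hF.homogeneous, abs_of_pos ht]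
  exact (h2.unique h1).le

/-- A smooth cutoff, vanishing for `s ≤ 1 / 4` and equal to `1` for `s ≥ 1 / 2`. -/
noncomputable def cutoff (s : ℝ) : ℝ := Real.smoothTransition (4 * s - 1)

/-- A `C¹` monotone vector field which is the gradient of `F` away from a neighbourhood of the
origin. -/
noncomputable def regGrad (F : E N → ℝ) (ξ : E N) : E N := cutoff (F ξ) • grad F ξ

lemma cutoff_nonneg (s : ℝ) : 0 ≤ cutoff s := Real.smoothTransition.nonneg _

lemma cutoff_le_one (s : ℝ) : cutoff s ≤ 1 := Real.smoothTransition.le_one _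

lemma cutoff_mono : Monotone cutoff := fun _ _ h =>
  Real.smoothTransition.monotone (by linarith)

lemma cutoff_of_le {s : ℝ} (h : s ≤ 1 / 4) : cutoff s = 0 :=
  Real.smoothTransition.zero_of_nonpos (by linarith)

lemma cutoff_one : cutoff 1 = 1 := Real.smoothTransition.one_of_one_le (by norm_num)

lemma IsAdmissible.contDiff_regGrad (hF : IsAdmissible p F) : ContDiff ℝ 1 (regGrad F) := by
  refine contDiff_iff_contDiffAt.2 fun ξ => ?_
  rcases eq_or_ne ξ 0 with rfl | hξ
  · refine (contDiffAt_const (c := (0 : E N))).congr_of_eventuallyEq ?_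
    have h : ∀ᶠ ξ in 𝓝 (0 : E N), F ξ < 1 / 4 :=
      hF.continuous.continuousAt.eventually_lt continuousAt_const (by simp [hF.map_zero])
    filter_upwards [h] with ξ hξ
    simp [regGrad, cutoff_of_le hξ.le]
  · have h1 : ContDiffAt ℝ 1 F ξ :=
      (hF.contDiffOn.contDiffAt (isOpen_compl_singleton.mem_nhds hξ)).of_le (by norm_num)
    have h2 : ContDiff ℝ 1 Real.smoothTransition := Real.smoothTransition.contDiff (n := 1)
    have h3 : ContDiffAt ℝ 1 (fun ξ => cutoff (F ξ)) ξ :=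
      h2.contDiffAt.comp ξ ((contDiffAt_const.mul h1).sub contDiffAt_const)
    exact h3.smul (hF.contDiffAt_grad hξ)

lemma IsAdmissible.inner_regGrad_le_cutoff (hF : IsAdmissible p F) (ξ η : E N) :
    inner ℝ η (regGrad F ξ) ≤ cutoff (F ξ) * F η := by
  rw [regGrad, inner_smul_right]
  rcases eq_or_ne ξ 0 with rfl | hξ
  · simp [hF.map_zero, cutoff_of_le (show (0 : ℝ) ≤ 1 / 4 by norm_num)]
  · exact mul_le_mul_of_nonneg_left (hF.inner_grad_le hξ η) (cutoff_nonneg _)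

lemma IsAdmissible.inner_regGrad_le (hF : IsAdmissible p F) (ξ η : E N) :
    inner ℝ η (regGrad F ξ) ≤ F η :=
  (hF.inner_regGrad_le_cutoff ξ η).trans
    (mul_le_of_le_one_left (hF.nonneg η) (cutoff_le_one _))

lemma IsAdmissible.inner_regGrad_self (hF : IsAdmissible p F) (ξ : E N) :
    inner ℝ ξ (regGrad F ξ) = cutoff (F ξ) * F ξ := by
  rw [regGrad, inner_smul_right]
  rcases eq_or_ne ξ 0 with rfl | hξ
  · simp [hF.map_zero]
  · rw [hF.inner_grad_self hξ]

/-- Bounding the two cross terms by `inner_regGrad_le_cutoff` leaves at least `(cutoff (F ξ) -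
cutoff (F η)) * (F ξ - F η)`, which is nonnegative because `cutoff` is monotone. -/
lemma IsAdmissible.regGrad_monotone (hF : IsAdmissible p F) (ξ η : E N) :
    0 ≤ inner ℝ (ξ - η) (regGrad F ξ - regGrad F η) := by
  rw [inner_sub_left, inner_sub_right, inner_sub_right, hF.inner_regGrad_self,
    hF.inner_regGrad_self]
  have h1 := hF.inner_regGrad_le_cutoff ξ η
  have h2 := hF.inner_regGrad_le_cutoff η ξ
  have h3 : 0 ≤ (cutoff (F ξ) - cutoff (F η)) * (F ξ - F η) := by
    rcases le_total (F ξ) (F η) with h | h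
    · exact mul_nonneg_of_nonpos_of_nonpos (sub_nonpos.2 (cutoff_mono h)) (sub_nonpos.2 h)
    · exact mul_nonneg (sub_nonneg.2 (cutoff_mono h)) (sub_nonneg.2 h)
  nlinarith

lemma IsAdmissible.inner_fderiv_regGrad_nonneg (hF : IsAdmissible p F) (ξ v : E N) :
    0 ≤ inner ℝ v (fderiv ℝ (regGrad F) ξ v) := by
  have hd := (hF.contDiff_regGrad.differentiable (by norm_num) ξ).hasFDerivAt
  have h1 : HasDerivAt (fun t : ℝ => regGrad F (ξ + t • v)) (fderiv ℝ (regGrad F) ξ v) 0 := by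
    have h0 : HasDerivAt (fun t : ℝ => ξ + t • v) v 0 := by
      simpa using ((hasDerivAt_id (0 : ℝ)).smul_const v).const_add ξ
    have hd' : HasFDerivAt (regGrad F) (fderiv ℝ (regGrad F) ξ) (ξ + (0 : ℝ) • v) := by
      simpa using hd
    exact hd'.comp_hasDerivAt 0 h0
  have h2 := (tendsto_const_nhds (x := v)).inner (𝕜 := ℝ) h1.tendsto_slope_zero_right
  refine ge_of_tendsto h2 ?_
  filter_upwards [self_mem_nhdsWithin] with t ht
  have ht : 0 < t := ht
  have h3 := hF.regGrad_monotone (ξ + t • v) ξ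
  rw [add_sub_cancel_left, inner_smul_left] at h3
  simp only [zero_add, zero_smul, add_zero, inner_smul_right]
  exact mul_nonneg (inv_pos.2 ht).le (nonneg_of_mul_nonneg_right h3 ht)

end Gradient

end AnisotropicCheeger

namespace AnisotropicCheeger

/-! ### Smoothing a minimum of affine functions -/

section SoftMin

variable {N : ℕ}

/-- The partition function of the affine functions `x ↦ c - ⟨ν, x⟩`, `(ν, c) ∈ s`. -/
noncomputable def partitionFn (s : Finset (E N × ℝ)) (b : ℝ) (x : E N) : ℝ :=
  ∑ q ∈ s, Real.exp (b * (inner ℝ q.1 x - q.2))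

/-- The Gibbs weights of the affine functions `x ↦ c - ⟨ν, x⟩`, `(ν, c) ∈ s`. -/
noncomputable def gibbs (s : Finset (E N × ℝ)) (b : ℝ) (q : E N × ℝ) (x : E N) : ℝ :=
  Real.exp (b * (inner ℝ q.1 x - q.2) - Real.log (partitionFn s b x))

/-- A smooth concave approximation of the minimum of the affine functions `x ↦ c - ⟨ν, x⟩`,
`(ν, c) ∈ s`. -/
noncomputable def softMin (s : Finset (E N × ℝ)) (b : ℝ) (x : E N) : ℝ :=
  -(b⁻¹ * Real.log (partitionFn s b x))

/-- The Gibbs mean of the directions `ν`; it is minus the gradient of `softMin`. -/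
noncomputable def gibbsMean (s : Finset (E N × ℝ)) (b : ℝ) (x : E N) : E N :=
  ∑ q ∈ s, gibbs s b q x • q.1

variable {s : Finset (E N × ℝ)} {b : ℝ} {x : E N}

lemma partitionFn_pos (hs : s.Nonempty) : 0 < partitionFn s b x :=
  Finset.sum_pos (fun _ _ => Real.exp_pos _) hs

lemma gibbs_eq (hs : s.Nonempty) (q : E N × ℝ) :
    gibbs s b q x = (partitionFn s b x)⁻¹ * Real.exp (b * (inner ℝ q.1 x - q.2)) := by
  rw [gibbs, Real.exp_sub, Real.exp_log (partitionFn_pos hs)]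
  field_simp

lemma gibbs_pos (q : E N × ℝ) : 0 < gibbs s b q x := Real.exp_pos _

lemma sum_gibbs (hs : s.Nonempty) : ∑ q ∈ s, gibbs s b q x = 1 := by
  simp_rw [gibbs_eq hs, ← Finset.mul_sum]
  exact inv_mul_cancel₀ (partitionFn_pos hs).ne'

lemma hasFDerivAt_affine (b : ℝ) (q : E N × ℝ) (x : E N) :
    HasFDerivAt (fun x => b * (inner ℝ q.1 x - q.2)) (b • innerSL ℝ q.1) x := by
  have h : HasFDerivAt (fun x => inner ℝ q.1 x) (innerSL ℝ q.1) x :=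
    (innerSL ℝ q.1).hasFDerivAt
  simpa using (h.sub_const q.2).const_mul b

lemma hasFDerivAt_log_partitionFn (hs : s.Nonempty) :
    HasFDerivAt (fun x => Real.log (partitionFn s b x)) (b • innerSL ℝ (gibbsMean s b x)) x := by
  have h1 : HasFDerivAt (partitionFn s b)
      (∑ q ∈ s, Real.exp (b * (inner ℝ q.1 x - q.2)) • (b • innerSL ℝ q.1)) x :=
    HasFDerivAt.fun_sum fun q _ => (hasFDerivAt_affine b q x).exp
  refine (h1.log (partitionFn_pos hs).ne').congr_fderiv ?_
  ext v
  simp only [gibbsMean, gibbs_eq hs, _root_.smul_apply, innerSL_apply_apply,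
    sum_inner, inner_smul_left, _root_.sum_apply, smul_eq_mul, Finset.mul_sum]
  refine Finset.sum_congr rfl fun q _ => ?_
  simp
  ring

lemma hasFDerivAt_softMin (hs : s.Nonempty) (hb : b ≠ 0) :
    HasFDerivAt (softMin s b) (-innerSL ℝ (gibbsMean s b x)) x := by
  refine ((hasFDerivAt_log_partitionFn (b := b) (x := x) hs).const_mul b⁻¹).neg.congr_fderiv ?_
  rw [smul_smul, inv_mul_cancel₀ hb, one_smul]

lemma hasFDerivAt_gibbs (hs : s.Nonempty) (q : E N × ℝ) :
    HasFDerivAt (gibbs s b q)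
      (gibbs s b q x • (b • innerSL ℝ (q.1 - gibbsMean s b x))) x := by
  refine ((hasFDerivAt_affine b q x).sub
    (hasFDerivAt_log_partitionFn (b := b) hs)).exp.congr_fderiv ?_
  rw [← smul_sub, ← map_sub]
  rfl

lemma sum_gibbs_smul_sub (hs : s.Nonempty) (v : E N) :
    ∑ q ∈ s, (gibbs s b q x * inner ℝ (q.1 - gibbsMean s b x) v) = 0 := by
  have h : ∑ q ∈ s, gibbs s b q x • (q.1 - gibbsMean s b x) = 0 := by
    simp_rw [smul_sub]
    rw [Finset.sum_sub_distrib, ← Finset.sum_smul, sum_gibbs hs, one_smul]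
    exact sub_self _
  have := congrArg (fun w => inner ℝ w v) h
  simpa [sum_inner, inner_smul_left] using this

/-- The derivative of the Gibbs mean is `b` times the covariance of the Gibbs distribution. -/
lemma hasFDerivAt_gibbsMean (hs : s.Nonempty) :
    HasFDerivAt (gibbsMean s b)
      (∑ q ∈ s, (gibbs s b q x • (b • innerSL ℝ (q.1 - gibbsMean s b x))).smulRight
        (q.1 - gibbsMean s b x)) x := by
  have h1 : HasFDerivAt (gibbsMean s b)
      (∑ q ∈ s, (gibbs s b q x • (b • innerSL ℝ (q.1 - gibbsMean s b x))).smulRight q.1) x :=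
    HasFDerivAt.fun_sum fun q _ => (hasFDerivAt_gibbs hs q).smul_const q.1
  refine h1.congr_fderiv ?_
  symm
  ext1 v
  simp only [_root_.sum_apply, ContinuousLinearMap.smulRight_apply,
    _root_.smul_apply, innerSL_apply_apply, smul_eq_mul, smul_sub,
    Finset.sum_sub_distrib, sub_eq_self, ← Finset.sum_smul]
  rw [← smul_zero (0 : ℝ)]
  -- The weighted deviations from the mean sum to zero, so centring the second factor as well
  -- changes nothing.
  have h2 := sum_gibbs_smul_sub (b := b) (x := x) hs v
  have h3 : ∑ q ∈ s, gibbs s b q x * (b * inner ℝ (q.1 - gibbsMean s b x) v) = 0 := by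
    calc _ = b * ∑ q ∈ s, (gibbs s b q x * inner ℝ (q.1 - gibbsMean s b x) v) := by
          rw [Finset.mul_sum]
          exact Finset.sum_congr rfl fun q _ => by ring
      _ = 0 := by rw [h2, mul_zero]
  simp [h3]

lemma contDiff_affine (b : ℝ) (q : E N × ℝ) :
    ContDiff ℝ ∞ fun x => b * (inner ℝ q.1 x - q.2) :=
  contDiff_const.mul ((contDiff_const.inner ℝ contDiff_id).sub contDiff_const)

lemma contDiff_partitionFn : ContDiff ℝ ∞ (partitionFn s b) :=
  ContDiff.sum fun q _ => (contDiff_affine b q).exp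

lemma contDiff_log_partitionFn (hs : s.Nonempty) :
    ContDiff ℝ ∞ (fun x => Real.log (partitionFn s b x)) :=
  contDiff_partitionFn.log fun _ => (partitionFn_pos hs).ne'

lemma contDiff_softMin (hs : s.Nonempty) : ContDiff ℝ ∞ (softMin s b) :=
  (contDiff_const.mul (contDiff_log_partitionFn hs)).neg

lemma contDiff_gibbsMean (hs : s.Nonempty) : ContDiff ℝ ∞ (gibbsMean s b) := by
  exact ContDiff.sum fun q _ => ((contDiff_affine b q).sub
    (contDiff_log_partitionFn hs)).exp.smul contDiff_const

lemma softMin_le (hb : 0 < b) {q : E N × ℝ} (hq : q ∈ s) :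
    softMin s b x ≤ q.2 - inner ℝ q.1 x := by
  have h1 : Real.exp (b * (inner ℝ q.1 x - q.2)) ≤ partitionFn s b x :=
    Finset.single_le_sum (f := fun q : E N × ℝ => Real.exp (b * (inner ℝ q.1 x - q.2)))
      (fun _ _ => (Real.exp_pos _).le) hq
  have h2 := (Real.le_log_iff_exp_le (partitionFn_pos ⟨q, hq⟩)).2 h1
  have h3 : inner ℝ q.1 x - q.2 ≤ b⁻¹ * Real.log (partitionFn s b x) := by
    rwa [le_inv_mul_iff₀ hb]
  rw [softMin]
  linarith

/-- Each term of the partition function is at most `exp (-b m)`; counting the terms costs `log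
s.card / b`, which vanishes as `b → ∞`. -/
lemma le_softMin (hs : s.Nonempty) (hb : 0 < b) {m : ℝ}
    (hm : ∀ q ∈ s, m ≤ q.2 - inner ℝ q.1 x) : m - b⁻¹ * Real.log s.card ≤ softMin s b x := by
  have h1 : partitionFn s b x ≤ s.card * Real.exp (b * -m) := by
    rw [← nsmul_eq_mul]
    refine Finset.sum_le_card_nsmul _ _ _ fun q hq => ?_
    have := hm q hq
    gcongr
    linarith
  have h2 := Real.log_le_log (partitionFn_pos hs) h1
  have h0 : (s.card : ℝ) ≠ 0 := by exact_mod_cast hs.card_pos.ne'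
  rw [Real.log_mul h0 (Real.exp_pos _).ne', Real.log_exp] at h2
  have h3 : b⁻¹ * Real.log (partitionFn s b x) ≤ b⁻¹ * (Real.log s.card + b * -m) := by gcongr
  rw [mul_add, inv_mul_cancel_left₀ hb.ne'] at h3
  rw [softMin]
  linarith

/-- Where a single affine function realizes the minimum, the Gibbs mean converges to its
direction as the inverse temperature tends to infinity. -/
lemma tendsto_gibbsMean {q₀ : E N × ℝ} (hq₀ : q₀ ∈ s)
    (h : ∀ q ∈ s, q ≠ q₀ → q₀.2 - inner ℝ q₀.1 x < q.2 - inner ℝ q.1 x) :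
    Tendsto (fun b => gibbsMean s b x) atTop (𝓝 q₀.1) := by
  classical
  have hs : s.Nonempty := ⟨q₀, hq₀⟩
  -- The partition function dominates its `q₀` term, so every other weight is at most `exp (-b ·
  -- gap)`.
  have h0 : ∀ q ∈ s.erase q₀, Tendsto (fun b => gibbs s b q x) atTop (𝓝 0) := by
    intro q hq
    obtain ⟨hne, hqs⟩ := Finset.mem_erase.1 hq
    have hpos := sub_pos.2 (h q hqs hne)
    have h1 : Tendsto (fun b : ℝ => Real.exp (-(b * ((q.2 - inner ℝ q.1 x) -
        (q₀.2 - inner ℝ q₀.1 x))))) atTop (𝓝 0) :=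
      Real.tendsto_exp_neg_atTop_nhds_zero.comp (tendsto_id.atTop_mul_const hpos)
    refine tendsto_of_tendsto_of_tendsto_of_le_of_le tendsto_const_nhds h1
      (fun b => (gibbs_pos q).le) fun b => ?_
    have h2 : Real.exp (b * (inner ℝ q₀.1 x - q₀.2)) ≤ partitionFn s b x :=
      Finset.single_le_sum (f := fun q : E N × ℝ => Real.exp (b * (inner ℝ q.1 x - q.2)))
        (fun _ _ => (Real.exp_pos _).le) hq₀
    have h3 := (Real.le_log_iff_exp_le (partitionFn_pos hs)).2 h2
    refine Real.exp_le_exp.2 ?_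
    linarith
  have h1 : Tendsto (fun b => gibbs s b q₀ x) atTop (𝓝 1) := by
    have h2 := (tendsto_const_nhds (x := (1 : ℝ))).sub (tendsto_finsetSum _ h0)
    simp only [Finset.sum_const_zero, sub_zero] at h2
    refine h2.congr fun b => ?_
    rw [← sum_gibbs (b := b) (x := x) hs, ← Finset.add_sum_erase s _ hq₀, add_sub_cancel_right]
  have h2 : Tendsto (fun b => gibbs s b q₀ x • q₀.1 + ∑ q ∈ s.erase q₀, gibbs s b q x • q.1) atTop
      (𝓝 ((1 : ℝ) • q₀.1 + ∑ q ∈ s.erase q₀, (0 : ℝ) • q.1)) :=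
    (h1.smul_const _).add (tendsto_finsetSum _ fun q hq => (h0 q hq).smul_const _)
  simp only [one_smul, zero_smul, Finset.sum_const_zero, add_zero] at h2
  refine h2.congr fun b => ?_
  rw [gibbsMean, ← Finset.add_sum_erase s _ hq₀]

/-- Almost every point has a single affine function realizing the minimum. -/
lemma ae_exists_unique_min (hs : s.Nonempty) :
    ∀ᵐ x : E N, ∃ q₀ ∈ s, ∀ q ∈ s, q ≠ q₀ → q₀.2 - inner ℝ q₀.1 x < q.2 - inner ℝ q.1 x := by
  have h1 : ∀ q ∈ s, ∀ r ∈ s, q ≠ r → ∀ᵐ x : E N, q.2 - inner ℝ q.1 x ≠ r.2 - inner ℝ r.1 x := by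
    intro q _ r _ hqr
    -- Parallel functions differ by a nonzero constant and never tie; the others tie on a
    -- hyperplane, which is null.
    by_cases hν : q.1 = r.1
    · refine Eventually.of_forall fun x hx => hqr (Prod.ext hν ?_)
      rw [hν] at hx
      linarith
    · have hν' : q.1 - r.1 ≠ 0 := sub_ne_zero.2 hν
      have hn : inner ℝ (q.1 - r.1) (q.1 - r.1) ≠ (0 : ℝ) := inner_self_ne_zero.2 hν'
      let S : AffineSubspace ℝ (E N) :=
        { carrier := {x | inner ℝ (q.1 - r.1) x = q.2 - r.2}
          smul_vsub_vadd_mem' := by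
            intro t x y z hx hy hz
            simp only [Set.mem_ofPred_eq, vsub_eq_sub, vadd_eq_add, inner_add_right,
              inner_smul_right] at *
            rw [inner_sub_right, hx, hy, hz]
            ring }
      have hS : S ≠ ⊤ := by
        intro h
        have ha : (0 : E N) ∈ S := h ▸ AffineSubspace.mem_top ℝ (E N) 0
        have hb : q.1 - r.1 ∈ S := h ▸ AffineSubspace.mem_top ℝ (E N) _
        have ha' : inner ℝ (q.1 - r.1) (0 : E N) = q.2 - r.2 := ha
        have hb' : inner ℝ (q.1 - r.1) (q.1 - r.1) = q.2 - r.2 := hb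
        rw [inner_zero_right] at ha'
        exact hn (hb'.trans ha'.symm)
      have h2 := Measure.addHaar_affineSubspace volume S hS
      refine measure_mono_null (fun x hx => ?_) h2
      simp only [Set.mem_compl_iff, Set.mem_ofPred_eq, not_not] at hx
      change inner ℝ (q.1 - r.1) x = q.2 - r.2
      rw [inner_sub_left]
      linarith
  have h2 : ∀ᵐ x : E N, ∀ q ∈ s, ∀ r ∈ s, q ≠ r → q.2 - inner ℝ q.1 x ≠ r.2 - inner ℝ r.1 x := by
    rw [eventually_all_finset]
    intro q hq
    rw [eventually_all_finset]
    intro r hr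
    by_cases hqr : q = r
    · exact Eventually.of_forall fun x hx => absurd hqr hx
    · filter_upwards [h1 q hq r hr hqr] with x hx _ using hx
  filter_upwards [h2] with x hx
  obtain ⟨q₀, hq₀, hmin⟩ := s.exists_min_image (fun q => q.2 - inner ℝ q.1 x) hs
  exact ⟨q₀, hq₀, fun q hq hne => lt_of_le_of_ne (hmin q hq) (hx q₀ hq₀ q hq hne.symm)⟩

end SoftMin

end AnisotropicCheeger

namespace AnisotropicCheeger

/-! ### Divergence of vector fields -/

section Divergence

variable {N : ℕ}

lemma continuous_divergence {σ : E N → E N} (hσ : ContDiff ℝ 1 σ) :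
    Continuous (divergence σ) := by
  refine continuous_finsetSum _ fun i _ => ?_
  have h := (hσ.continuous_fderiv (by norm_num)).clm_apply
    (continuous_const (y := EuclideanSpace.single i (1 : ℝ)))
  fun_prop

lemma hasCompactSupport_divergence {σ : E N → E N} (hσ : HasCompactSupport σ) :
    HasCompactSupport (divergence σ) := by
  refine (hσ.fderiv (𝕜 := ℝ)).mono fun x hx h => hx ?_
  simp [divergence, h]

lemma integrable_divergence {σ : E N → E N} (hσ : ContDiff ℝ 1 σ) (hc : HasCompactSupport σ) :
    Integrable (divergence σ) :=
  (continuous_divergence hσ).integrable_of_hasCompactSupport (hasCompactSupport_divergence hc)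

lemma divergence_smul {t : E N → ℝ} {t' : E N →L[ℝ] ℝ} {V : E N → E N} {x : E N}
    (ht : HasFDerivAt t t' x) (hV : DifferentiableAt ℝ V x) :
    divergence (fun y => t y • V y) x = t' (V x) + t x * divergence V x := by
  have h := (ht.fun_smul hV.hasFDerivAt).fderiv
  rw [divergence, h]
  conv_rhs => rw [← sum_smul_single (V x), map_sum]
  rw [divergence, Finset.mul_sum, ← Finset.sum_add_distrib]
  refine Finset.sum_congr rfl fun i _ => ?_
  simp
  ring

lemma divergence_congr {σ τ : E N → E N} {x : E N} (h : σ =ᶠ[𝓝 x] τ) :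
    divergence σ x = divergence τ x := by
  rw [divergence, h.fderiv_eq, divergence]

end Divergence

/-! ### The calibrating field and the perimeter bound -/

section Calibration

variable {N : ℕ} {p : ℝ} {F : E N → ℝ} {s : Finset (E N × ℝ)} {b : ℝ}

/-- By the chain rule the divergence is `-b` times the Gibbs average of `⟨a, D(regGrad F) a⟩` over
the deviations `a` from the mean, and each of these is nonnegative by monotonicity. No symmetry of
`D(regGrad F)` is needed. -/
lemma IsAdmissible.divergence_regGrad_gibbsMean_nonpos (hF : IsAdmissible p F) (hs : s.Nonempty)
    (hb : 0 ≤ b) (x : E N) :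
    divergence (fun y => regGrad F (-gibbsMean s b y)) x ≤ 0 := by
  set u := -gibbsMean s b x
  have hd := (hF.contDiff_regGrad.differentiable (by norm_num) u).hasFDerivAt
  have h1 := (hd.comp x (hasFDerivAt_gibbsMean (b := b) (x := x) hs).neg).fderiv
  have h2 : divergence (fun y => regGrad F (-gibbsMean s b y)) x =
      -∑ q ∈ s, gibbs s b q x * b * inner ℝ (q.1 - gibbsMean s b x)
        (fderiv ℝ (regGrad F) u (q.1 - gibbsMean s b x)) := by
    have h3 : ∀ v : E N, fderiv ℝ (regGrad F ∘ (-gibbsMean s b)) x v =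
        -∑ q ∈ s, (gibbs s b q x * (b * inner ℝ (q.1 - gibbsMean s b x) v)) •
          fderiv ℝ (regGrad F) u (q.1 - gibbsMean s b x) := by
      intro v
      rw [h1]
      change fderiv ℝ (regGrad F) u (-((∑ q ∈ s, (gibbs s b q x •
        (b • innerSL ℝ (q.1 - gibbsMean s b x))).smulRight (q.1 - gibbsMean s b x) :
          E N →L[ℝ] E N) v)) = _
      rw [_root_.map_neg, _root_.sum_apply, map_sum]
      congr 1
      refine Finset.sum_congr rfl fun q _ => ?_
      rw [ContinuousLinearMap.smulRight_apply, map_smul]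
      rfl
    rw [divergence]
    change ∑ i, (fderiv ℝ (regGrad F ∘ (-gibbsMean s b)) x (EuclideanSpace.single i 1)) i = _
    simp only [h3, PiLp.neg_apply, Finset.sum_neg_distrib, WithLp.ofLp_sum, Finset.sum_apply]
    congr 1
    rw [Finset.sum_comm]
    refine Finset.sum_congr rfl fun q _ => ?_
    rw [PiLp.inner_apply, Finset.mul_sum]
    refine Finset.sum_congr rfl fun i _ => ?_
    generalize q.1 - gibbsMean s b x = a
    simp [EuclideanSpace.inner_single_right]
    ring
  rw [h2, neg_nonpos]
  exact Finset.sum_nonneg fun q _ => mul_nonneg (mul_nonneg (gibbs_pos q).le hb)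
    (hF.inner_fderiv_regGrad_nonneg _ _)

lemma IsAdmissible.map_sum_le (hF : IsAdmissible p F) {ι : Type*} (t : Finset ι) (w : ι → ℝ)
    (v : ι → E N) (hw : ∀ i ∈ t, 0 ≤ w i) (hv : ∀ i ∈ t, F (v i) ≤ 1) :
    F (∑ i ∈ t, w i • v i) ≤ ∑ i ∈ t, w i := by
  classical
  induction t using Finset.induction_on with
  | empty => simp [hF.map_zero]
  | insert a t ha ih =>
    rw [Finset.sum_insert ha, Finset.sum_insert ha]
    refine (hF.add_le _ _).trans (add_le_add ?_ (ih (fun i hi => hw i (Finset.mem_insert_of_mem hi))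
      fun i hi => hv i (Finset.mem_insert_of_mem hi)))
    have h1 := hw a (Finset.mem_insert_self a t)
    rw [hF.homogeneous, abs_of_nonneg h1]
    exact mul_le_of_le_one_right h1 (hv a (Finset.mem_insert_self a t))

lemma IsAdmissible.map_gibbsMean_le_one (hF : IsAdmissible p F) (hs : s.Nonempty)
    (h1 : ∀ q ∈ s, F q.1 = 1) (x : E N) : F (gibbsMean s b x) ≤ 1 :=
  (hF.map_sum_le s _ _ (fun q _ => (gibbs_pos q).le) fun q hq => (h1 q hq).le).trans
    (sum_gibbs hs).le

/-- The calibrating vector field, before truncation: its divergence is at least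
`F (∇ softMin) / c`, up to the cutoff. -/
lemma IsAdmissible.le_divergence (hF : IsAdmissible p F) (hs : s.Nonempty) (hb : 0 < b)
    {R c : ℝ} (hc : 0 < c) {x : E N} (hR : softMin s b x ≤ R) :
    c⁻¹ * (cutoff (F (gibbsMean s b x)) * F (gibbsMean s b x)) ≤
      divergence (fun y => (c⁻¹ * (softMin s b y - R)) • regGrad F (-gibbsMean s b y)) x := by
  have ht : HasFDerivAt (fun y => c⁻¹ * (softMin s b y - R))
      (c⁻¹ • -innerSL ℝ (gibbsMean s b x)) x :=
    ((hasFDerivAt_softMin hs hb.ne').sub_const R).const_mul c⁻¹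
  have hV : DifferentiableAt ℝ (fun y => regGrad F (-gibbsMean s b y)) x := by
    have hu : DifferentiableAt ℝ (fun y => -gibbsMean s b y) x :=
      (hasFDerivAt_gibbsMean hs).differentiableAt.fun_neg
    exact (hF.contDiff_regGrad.differentiable (by norm_num)).differentiableAt.fun_comp' x hu
  rw [divergence_smul ht hV]
  have h1 := hF.inner_regGrad_self (-gibbsMean s b x)
  rw [inner_neg_left, hF.map_neg] at h1
  have h2 : (c⁻¹ • -innerSL ℝ (gibbsMean s b x)) (regGrad F (-gibbsMean s b x)) =
      c⁻¹ * (cutoff (F (gibbsMean s b x)) * F (gibbsMean s b x)) := by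
    rw [← h1]
    simp
  rw [h2, le_add_iff_nonneg_right]
  refine mul_nonneg_of_nonpos_of_nonpos ?_ (hF.divergence_regGrad_gibbsMean_nonpos hs hb.le x)
  exact mul_nonpos_of_nonneg_of_nonpos (inv_pos.2 hc).le (sub_nonpos.2 hR)

/-- Almost everywhere the Gibbs mean tends to a direction with `F = 1`, where the cutoff is `1`.
Dominated convergence applies with bound `1` on the finite-measure set `K`. -/
lemma IsAdmissible.tendsto_integral_cutoff (hF : IsAdmissible p F) (hs : s.Nonempty)
    (h1 : ∀ q ∈ s, F q.1 = 1) {K : Set (E N)} (hK : volume K ≠ ⊤) :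
    Tendsto (fun b => ∫ x in K, cutoff (F (gibbsMean s b x)) * F (gibbsMean s b x)) atTop
      (𝓝 (volume.real K)) := by
  have hcont : Continuous fun r => cutoff r * r := by
    have : Continuous cutoff := Real.smoothTransition.continuous.comp (by fun_prop)
    exact this.mul continuous_id
  have : IsFiniteMeasure (volume.restrict K) := ⟨by simpa using hK.lt_top⟩
  have h : Tendsto (fun b => ∫ x in K, cutoff (F (gibbsMean s b x)) * F (gibbsMean s b x)) atTop
      (𝓝 (∫ x in K, (1 : ℝ))) := by
    refine tendsto_integral_filter_of_dominated_convergence (fun _ => 1) ?_ ?_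
      (integrable_const 1) ?_
    · refine Eventually.of_forall fun b => Continuous.aestronglyMeasurable ?_
      exact hcont.comp (hF.continuous.comp (contDiff_gibbsMean hs).continuous)
    · refine Eventually.of_forall fun b => Eventually.of_forall fun x => ?_
      rw [Real.norm_of_nonneg (mul_nonneg (cutoff_nonneg _) (hF.nonneg _))]
      exact mul_le_one₀ (cutoff_le_one _) (hF.nonneg _) (hF.map_gibbsMean_le_one hs h1 x)
    · refine ae_restrict_of_ae ?_
      filter_upwards [ae_exists_unique_min hs] with x ⟨q₀, hq₀, hx⟩
      have h2 := (hF.continuous.tendsto q₀.1).comp (tendsto_gibbsMean hq₀ hx)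
      rw [h1 q₀ hq₀] at h2
      have h3 := (hcont.tendsto 1).comp h2
      simpa [cutoff_one, Function.comp_def] using h3
  simpa [Measure.real] using h

lemma IsAdmissible.le_perimeter (hF : IsAdmissible p F) {Ω K : Set (E N)} (hΩ : IsOpen Ω)
    (hbdd : Bornology.IsBounded Ω) (hKm : MeasurableSet K) (hKΩ : K ⊆ Ω) (hs : s.Nonempty)
    (h1 : ∀ q ∈ s, F q.1 = 1) (h0 : ∀ q ∈ s, ∀ x ∈ Ω, inner ℝ q.1 x ≤ q.2) {R η : ℝ}
    (hR : 0 < R) (hη : 0 < η) (h2 : ∀ x ∈ closure Ω, ∃ q ∈ s, q.2 - inner ℝ q.1 x < R) :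
    ENNReal.ofReal (volume.real K / (R + 2 * η)) ≤ perimeter F K := by
  have hKfin : volume K ≠ ⊤ := (hbdd.subset hKΩ).measure_lt_top.ne
  have hc : 0 < R + 2 * η := by positivity
  have haff : ∀ q : E N × ℝ, Continuous fun x : E N => q.2 - inner ℝ q.1 x := fun q =>
    continuous_const.sub (continuous_const.inner continuous_id)
  obtain ⟨r, hr⟩ := hbdd.closure.subset_ball (0 : E N)
  -- A bounded open neighbourhood of `closure Ω` where the affine functions stay above `-η` and
  -- their minimum below `R`. It leaves room for the cutoff `χ`, equal to `1` on `closure Ω`.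
  let U : Set (E N) := ((⋂ q ∈ s, {x | -η < q.2 - inner ℝ q.1 x}) ∩
    ⋃ q ∈ s, {x | q.2 - inner ℝ q.1 x < R}) ∩ Metric.ball 0 r
  have hU : IsOpen U := by
    refine IsOpen.inter (IsOpen.inter ?_ ?_) Metric.isOpen_ball
    · exact isOpen_biInter_finset fun q _ => isOpen_lt continuous_const (haff q)
    · exact isOpen_biUnion fun q _ => isOpen_lt (haff q) continuous_const
  have hΩU : closure Ω ⊆ U := by
    intro x hx
    refine ⟨⟨Set.mem_iInter₂.2 fun q hq => ?_, ?_⟩, hr hx⟩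
    · have h3 : closure Ω ⊆ {x | 0 ≤ q.2 - inner ℝ q.1 x} :=
        closure_minimal (fun y hy => sub_nonneg.2 (h0 q hq y hy))
          (isClosed_le continuous_const (haff q))
      exact (neg_lt_zero.2 hη).trans_le (h3 hx)
    · obtain ⟨q, hq, hqx⟩ := h2 x hx
      exact Set.mem_iUnion₂.2 ⟨q, hq, hqx⟩
  obtain ⟨χ, hχd, hχr, hχs, hχ1⟩ := exists_contMDiff_support_eq_eq_one_iff
    (modelWithCornersSelf ℝ (E N)) (n := 1) hU isClosed_closure hΩU
  rw [contMDiff_iff_contDiff] at hχd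
  have hχ01 : ∀ x, 0 ≤ χ x ∧ χ x ≤ 1 := fun x => hχr ⟨x, rfl⟩
  have hlog : ∀ᶠ b : ℝ in atTop, b⁻¹ * Real.log s.card ≤ η := by
    have h3 := tendsto_inv_atTop_zero.mul_const (Real.log s.card)
    rw [zero_mul] at h3
    exact h3.eventually_le_const hη
  have hlim := ENNReal.tendsto_ofReal
    ((hF.tendsto_integral_cutoff hs h1 hKfin).const_mul (R + 2 * η)⁻¹)
  rw [inv_mul_eq_div] at hlim
  refine le_of_tendsto hlim ?_
  filter_upwards [hlog, eventually_gt_atTop 0] with b hb hb0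
  let σ : E N → E N := fun x =>
    χ x • (((R + 2 * η)⁻¹ * (softMin s b x - R)) • regGrad F (-gibbsMean s b x))
  have hσd : ContDiff ℝ 1 σ := by
    have hg : ContDiff ℝ 1 (gibbsMean s b) := (contDiff_gibbsMean hs).of_le (by simp)
    have hm : ContDiff ℝ 1 (softMin s b) := (contDiff_softMin hs).of_le (by simp)
    exact hχd.smul ((contDiff_const.mul (hm.sub contDiff_const)).smul
      (hF.contDiff_regGrad.comp hg.neg))
  have hσc : HasCompactSupport σ := by
    refine HasCompactSupport.of_support_subset_isCompact (isCompact_closedBall (0 : E N) r) ?_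
    refine (Function.support_smul_subset_left χ _).trans ?_
    rw [hχs]
    exact Set.inter_subset_right.trans Metric.ball_subset_closedBall
  have hσp : ∀ x, polar F (σ x) ≤ 1 := by
    intro x
    change polar F (χ x • (_ • _)) ≤ 1
    rw [smul_smul]
    refine (hF.polar_smul_le zero_le_one fun ξ => ?_).trans ?_
    · rw [one_mul]
      exact hF.inner_regGrad_le _ ξ
    · rw [mul_one, abs_mul, abs_of_nonneg (hχ01 x).1]
      by_cases hx : x ∈ U
      · refine mul_le_one₀ (hχ01 x).2 (abs_nonneg _) ?_
        obtain ⟨⟨hx1, hx2⟩, -⟩ := hx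
        rw [Set.mem_iInter₂] at hx1
        obtain ⟨q, hq, hqx⟩ := Set.mem_iUnion₂.1 hx2
        -- One `η` is lost on leaving `Ω` and one in smoothing: `-2η ≤ softMin < R` on `U`, hence
        -- `|softMin - R| ≤ R + 2η`.
        have h3 := le_softMin hs hb0 fun q hq => (hx1 q hq).le
        have h4 : softMin s b x ≤ q.2 - inner ℝ q.1 x := softMin_le hb0 hq
        have h5 : q.2 - inner ℝ q.1 x < R := hqx
        rw [abs_mul, abs_of_pos (inv_pos.2 hc), inv_mul_le_iff₀ hc, mul_one, abs_le]
        constructor <;> linarith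
      · have : χ x = 0 := by
          rw [← hχs] at hx
          simpa using hx
        simp [this]
  have hmono : (R + 2 * η)⁻¹ * ∫ x in K, cutoff (F (gibbsMean s b x)) * F (gibbsMean s b x) ≤
      ∫ x in K, divergence σ x := by
    rw [← integral_const_mul]
    refine integral_mono_of_nonneg ?_ (integrable_divergence hσd hσc).integrableOn ?_
    · exact Eventually.of_forall fun x => mul_nonneg (inv_pos.2 hc).le
        (mul_nonneg (cutoff_nonneg _) (hF.nonneg _))
    · refine (ae_restrict_iff' hKm).2 (Eventually.of_forall fun x hx => ?_)
      have hxΩ := hKΩ hx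
      obtain ⟨q, hq, hqx⟩ := h2 x (subset_closure hxΩ)
      refine (hF.le_divergence hs hb0 hc ((softMin_le hb0 hq).trans hqx.le)).trans_eq ?_
      refine divergence_congr ?_
      filter_upwards [hΩ.mem_nhds hxΩ] with y hy
      simp [σ, (hχ1 y).1 (subset_closure hy)]
  refine (ENNReal.ofReal_le_ofReal hmono).trans ?_
  exact le_iSup₂_of_le σ hσd (le_iSup₂_of_le hσc hσp le_rfl)

end Calibration

end AnisotropicCheeger

namespace AnisotropicCheeger

/-! ### Inradius, supporting half-spaces and the lower bound -/

section Inradius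

variable {N : ℕ} {p : ℝ} {F : E N → ℝ} {Ω : Set (E N)}

lemma frontier_nonempty [Nontrivial (E N)] (hb : Bornology.IsBounded Ω) (hne : Ω.Nonempty) :
    (frontier Ω).Nonempty := by
  refine nonempty_frontier_iff.2 ⟨hne, ?_⟩
  rintro rfl
  exact NormedSpace.unbounded_univ ℝ (E N) hb

lemma IsAdmissible.distBoundary_le (hF : IsAdmissible p F) {y : E N} (hy : y ∈ frontier Ω)
    (x : E N) : distBoundary F Ω x ≤ polar F (x - y) :=
  ciInf_le ⟨0, by rintro _ ⟨z, rfl⟩; exact hF.polar_nonneg _⟩ (⟨y, hy⟩ : frontier Ω)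

lemma IsAdmissible.bddAbove_distBoundary [Nontrivial (E N)] (hF : IsAdmissible p F)
    (hb : Bornology.IsBounded Ω) (hne : Ω.Nonempty) :
    BddAbove (Set.range fun x : Ω => distBoundary F Ω x.1) := by
  obtain ⟨y, hy⟩ := frontier_nonempty hb hne
  obtain ⟨C, hC, h⟩ := hF.exists_polar_le
  refine ⟨C * Metric.diam (closure Ω), ?_⟩
  rintro _ ⟨⟨x, hx⟩, rfl⟩
  refine (hF.distBoundary_le hy x).trans ((h _).trans ?_)
  gcongr
  rw [← dist_eq_norm]
  exact Metric.dist_le_diam_of_mem hb.closure (subset_closure hx) (frontier_subset_closure hy)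

lemma IsAdmissible.distBoundary_le_inradius [Nontrivial (E N)] (hF : IsAdmissible p F)
    (hb : Bornology.IsBounded Ω) {x : E N} (hx : x ∈ Ω) : distBoundary F Ω x ≤ inradius F Ω :=
  le_ciSup (hF.bddAbove_distBoundary hb ⟨x, hx⟩) (⟨x, hx⟩ : Ω)

lemma IsAdmissible.inradius_pos [Nontrivial (E N)] (hF : IsAdmissible p F) (hΩ : IsOpen Ω)
    (hb : Bornology.IsBounded Ω) (hne : Ω.Nonempty) : 0 < inradius F Ω := by
  obtain ⟨x, hx⟩ := hne
  obtain ⟨r, hr, hball⟩ := Metric.isOpen_iff.1 hΩ x hx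
  obtain ⟨c, hc, h⟩ := hF.exists_le_polar
  have : Nonempty (frontier Ω) := (frontier_nonempty hb ⟨x, hx⟩).to_subtype
  refine lt_of_lt_of_le (mul_pos hc hr) (le_trans ?_ (hF.distBoundary_le_inradius hb hx))
  refine le_ciInf fun y => le_trans ?_ (h _)
  gcongr
  by_contra! hlt
  rw [← dist_eq_norm, dist_comm] at hlt
  have := y.2.2
  rw [hΩ.interior_eq] at this
  exact this (hball hlt)

lemma IsAdmissible.exists_supporting (hF : IsAdmissible p F) (hΩ : IsOpen Ω) (hc : Convex ℝ Ω)
    (hne : Ω.Nonempty) {y : E N} (hy : y ∉ Ω) :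
    ∃ ν : E N, F ν = 1 ∧ ∀ z ∈ Ω, inner ℝ ν z ≤ inner ℝ ν y := by
  obtain ⟨f, hf⟩ := geometric_hahn_banach_open_point hc hΩ hy
  obtain ⟨ν, rfl⟩ := (InnerProductSpace.toDual ℝ (E N)).surjective f
  simp only [InnerProductSpace.toDual_apply_apply] at hf
  obtain ⟨z, hz⟩ := hne
  have hν : ν ≠ 0 := by
    rintro rfl
    simpa using hf z hz
  have hp := hF.pos hν
  refine ⟨(F ν)⁻¹ • ν, ?_, fun z hz => ?_⟩
  · rw [hF.homogeneous, abs_of_pos (inv_pos.2 hp), inv_mul_cancel₀ hp.ne']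
  · rw [real_inner_smul_left, real_inner_smul_left]
    exact mul_le_mul_of_nonneg_left (hf z hz).le (inv_pos.2 hp).le

/-- Up to an arbitrarily small error, a convex set is contained in a half-space
whose boundary is at anisotropic distance at most the inradius from a given point. -/
lemma IsAdmissible.exists_supporting_lt [Nontrivial (E N)] (hF : IsAdmissible p F)
    (hΩ : IsOpen Ω) (hc : Convex ℝ Ω) (hb : Bornology.IsBounded Ω) (hne : Ω.Nonempty) {δ : ℝ}
    (hδ : 0 < δ) (x : E N) :
    ∃ q : E N × ℝ, F q.1 = 1 ∧ (∀ z ∈ Ω, inner ℝ q.1 z ≤ q.2) ∧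
      q.2 - inner ℝ q.1 x < inradius F Ω + δ := by
  have hfr : ∀ y ∈ frontier Ω, y ∉ Ω := fun y hy => by
    have := hy.2
    rwa [hΩ.interior_eq] at this
  by_cases hxΩ : x ∈ Ω
  · have : Nonempty (frontier Ω) := (frontier_nonempty hb hne).to_subtype
    have h1 : distBoundary F Ω x < inradius F Ω + δ := by
      linarith [hF.distBoundary_le_inradius hb hxΩ]
    obtain ⟨⟨y, hy⟩, hxy⟩ := exists_lt_of_ciInf_lt h1
    obtain ⟨ν, hν, h⟩ := hF.exists_supporting hΩ hc hne (hfr y hy)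
    refine ⟨(ν, inner ℝ ν y), hν, h, lt_of_le_of_lt ?_ hxy⟩
    -- The half-space supports `Ω` at a nearly closest boundary point `y`, and `⟨ν, y - x⟩ ≤ F°(x -
    -- y)` as `F ν = 1`.
    have h2 := hF.inner_le_mul_polar (-ν) (x - y)
    rw [hF.map_neg, hν, one_mul, inner_neg_left, inner_sub_right] at h2
    simp only
    linarith
  -- For `x` outside `Ω` the bounding hyperplane can pass through `x` itself.
  · obtain ⟨ν, hν, h⟩ := hF.exists_supporting hΩ hc hne hxΩ
    refine ⟨(ν, inner ℝ ν x), hν, h, ?_⟩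
    simp only [sub_self]
    linarith [hF.inradius_pos hΩ hb hne]

theorem IsAdmissible.one_div_inradius_le_cheegerConstant [Nontrivial (E N)]
    (hF : IsAdmissible p F) (hΩ : IsOpen Ω) (hc : Convex ℝ Ω) (hb : Bornology.IsBounded Ω)
    (hne : Ω.Nonempty) : 1 / ENNReal.ofReal (inradius F Ω) ≤ cheegerConstant F Ω := by
  classical
  have hR := hF.inradius_pos hΩ hb hne
  set R := inradius F Ω
  refine le_iInf fun K => le_iInf fun hKm => le_iInf fun hKΩ => le_iInf fun hK0 => ?_
  have hKfin : volume K ≠ ⊤ := (hb.subset hKΩ).measure_lt_top.ne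
  rw [ENNReal.le_div_iff_mul_le (Or.inl hK0.ne') (Or.inl hKfin), ← ENNReal.ofReal_toReal hKfin,
    ← ENNReal.ofReal_one, ← ENNReal.ofReal_div_of_pos hR, ← ENNReal.ofReal_mul (by positivity),
    one_div_mul_eq_div]
  -- The first `η` comes from the near-optimal half-spaces, the `2 * η` from `le_perimeter`.
  have hη : ∀ η : ℝ, 0 < η → ENNReal.ofReal (volume.real K / (R + η + 2 * η)) ≤
      perimeter F K := by
    intro η hη
    choose q hq using hF.exists_supporting_lt hΩ hc hb hne hη
    have hcover : ∀ x ∈ closure Ω, {y | (q x).2 - inner ℝ (q x).1 y < R + η} ∈ 𝓝 x := by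
      intro x _
      refine IsOpen.mem_nhds (isOpen_lt ?_ continuous_const) (hq x).2.2
      exact continuous_const.sub (continuous_const.inner continuous_id)
    obtain ⟨t, -, htc⟩ := hb.isCompact_closure.elim_nhds_subcover _ hcover
    have h2 : ∀ x ∈ closure Ω, ∃ r ∈ t.image q, r.2 - inner ℝ r.1 x < R + η := by
      intro x hx
      obtain ⟨y, hy, hxy⟩ := Set.mem_iUnion₂.1 (htc hx)
      exact ⟨q y, Finset.mem_image_of_mem _ hy, hxy⟩
    obtain ⟨x, hx⟩ := hne
    obtain ⟨r, hr, -⟩ := h2 x (subset_closure hx)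
    refine hF.le_perimeter hΩ hb hKm hKΩ ⟨r, hr⟩ ?_ ?_ (by positivity) hη h2
    · intro r hr
      obtain ⟨y, hy, rfl⟩ := Finset.mem_image.1 hr
      exact (hq y).1
    · intro r hr
      obtain ⟨y, hy, rfl⟩ := Finset.mem_image.1 hr
      exact (hq y).2.1
  have hlim : Tendsto (fun η : ℝ => ENNReal.ofReal (volume.real K / (R + η + 2 * η))) (𝓝[>] 0)
      (𝓝 (ENNReal.ofReal (volume.real K / R))) := by
    refine ENNReal.tendsto_ofReal (tendsto_nhdsWithin_of_tendsto_nhds ?_)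
    have : ContinuousAt (fun η : ℝ => volume.real K / (R + η + 2 * η)) 0 := by
      refine ContinuousAt.div (by fun_prop) (by fun_prop) ?_
      simpa using hR.ne'
    simpa [ContinuousAt] using this
  refine le_of_tendsto hlim ?_
  filter_upwards [self_mem_nhdsWithin] with η h using hη η h

end Inradius

end AnisotropicCheeger

namespace AnisotropicCheeger

/-! ### Boxes and optimality -/

section Box

variable {N : ℕ} {p : ℝ} {F : E N → ℝ} {r : Fin N → ℝ}

/-- The centred box with half-sides `r j`. -/
def box (r : Fin N → ℝ) : Set (E N) := {x | ∀ j, |x j| < r j}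

lemma rectangle_eq_box (i : Fin N) (a k : ℝ) :
    rectangle i a k = box fun j => if j = i then a else k := by
  ext x
  constructor
  · rintro ⟨h1, h2⟩ j
    by_cases hj : j = i
    · simpa [hj] using h1
    · simpa [hj] using h2 j hj
  · exact fun h => ⟨by simpa using h i, fun j hj => by simpa [hj] using h j⟩

lemma box_eq_iInter (r : Fin N → ℝ) :
    box r = ⋂ j, (EuclideanSpace.proj j : E N →L[ℝ] ℝ) ⁻¹' Metric.ball 0 (r j) := by
  ext x
  simp [box]

lemma isOpen_box (r : Fin N → ℝ) : IsOpen (box r) := by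
  rw [box_eq_iInter]
  exact isOpen_iInter_of_finite fun j =>
    Metric.isOpen_ball.preimage (ContinuousLinearMap.continuous _)

lemma convex_box (r : Fin N → ℝ) : Convex ℝ (box r) := by
  rw [box_eq_iInter]
  exact convex_iInter fun j =>
    (convex_ball (0 : ℝ) (r j)).linear_preimage (EuclideanSpace.proj j : E N →L[ℝ] ℝ).toLinearMap

lemma isBounded_box (r : Fin N → ℝ) : Bornology.IsBounded (box r) := by
  refine ((PiLp.antilipschitzWith_ofLp 2 fun _ : Fin N => ℝ).isBounded_preimage
    (Metric.isBounded_Icc (-r) r)).subset fun x hx => ?_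
  exact ⟨fun j => (abs_lt.1 (hx j)).1.le, fun j => (abs_lt.1 (hx j)).2.le⟩

lemma zero_mem_box (hr : ∀ j, 0 < r j) : (0 : E N) ∈ box r := fun j => by simpa using hr j

lemma toLp_preimage_box (r : Fin N → ℝ) :
    (WithLp.toLp 2 : (Fin N → ℝ) → E N) ⁻¹' box r =
      Set.pi Set.univ fun j => Set.Ioo (-r j) (r j) := by
  ext x
  simp [box, abs_lt]

lemma toLp_preimage_box_ae_eq (r : Fin N → ℝ) :
    (WithLp.toLp 2 : (Fin N → ℝ) → E N) ⁻¹' box r =ᵐ[volume] Set.Icc (-r) r := by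
  rw [toLp_preimage_box]
  exact Measure.univ_pi_Ioo_ae_eq_Icc

lemma volume_real_box (hr : ∀ j, 0 < r j) : volume.real (box r) = ∏ j, 2 * r j := by
  rw [Measure.real, ← (PiLp.volume_preserving_toLp (Fin N)).measure_preimage
    (isOpen_box r).measurableSet.nullMeasurableSet, measure_congr (toLp_preimage_box_ae_eq r),
    Real.volume_Icc_pi_toReal fun j => by
      have := hr j
      simp only [Pi.neg_apply]
      linarith]
  refine Finset.prod_congr rfl fun j _ => ?_
  simp only [Pi.neg_apply]
  ring

lemma setIntegral_box (r : Fin N → ℝ) (g : E N → ℝ) :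
    ∫ x in box r, g x = ∫ y in Set.Icc (-r) r, g (WithLp.toLp 2 y) := by
  rw [← (PiLp.volume_preserving_toLp (Fin N)).setIntegral_preimage_emb
    (MeasurableEquiv.toLp 2 (Fin N → ℝ)).measurableEmbedding]
  exact setIntegral_congr_set (toLp_preimage_box_ae_eq r)

lemma IsAdmissible.abs_apply_le (hF : IsAdmissible p F) {v : E N} (hv : polar F v ≤ 1)
    (j : Fin N) : |v j| ≤ F (EuclideanSpace.single j 1) := by
  have h : ∀ ξ, inner ℝ ξ v ≤ F ξ := fun ξ =>
    (hF.inner_le_mul_polar ξ v).trans (mul_le_of_le_one_right (hF.nonneg ξ) hv)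
  have h1 := h (EuclideanSpace.single j 1)
  have h2 := h (-EuclideanSpace.single j 1)
  rw [inner_neg_left, hF.map_neg] at h2
  simp only [EuclideanSpace.inner_single_left, map_one, one_mul] at h1 h2
  exact abs_le.2 ⟨by linarith, h1⟩

/-- On the two faces orthogonal to `e_j` the flux density is at most `F(e_j)` in absolute value, and
the area of each is the volume divided by `2 r_j`. -/
lemma IsAdmissible.integral_divergence_box_le {n : ℕ} {F : E (n + 1) → ℝ}
    (hF : IsAdmissible p F) {r : Fin (n + 1) → ℝ} (hr : ∀ j, 0 < r j)
    {σ : E (n + 1) → E (n + 1)} (hσ : ContDiff ℝ 1 σ) (hσp : ∀ x, polar F (σ x) ≤ 1) :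
    ∫ x in box r, divergence σ x ≤
      volume.real (box r) * ∑ j, F (EuclideanSpace.single j 1) / r j := by
  let e : E (n + 1) ≃L[ℝ] (Fin (n + 1) → ℝ) := EuclideanSpace.equiv (Fin (n + 1)) ℝ
  let f : (Fin (n + 1) → ℝ) → Fin (n + 1) → ℝ := fun y => e (σ (e.symm y))
  let f' : (Fin (n + 1) → ℝ) → (Fin (n + 1) → ℝ) →L[ℝ] (Fin (n + 1) → ℝ) := fun y =>
    (e : E (n + 1) →L[ℝ] (Fin (n + 1) → ℝ)).comp ((fderiv ℝ σ (e.symm y)).comp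
      (e.symm : (Fin (n + 1) → ℝ) →L[ℝ] E (n + 1)))
  have hf : ∀ y, HasFDerivAt f (f' y) y := fun y =>
    e.hasFDerivAt.comp y (((hσ.differentiable (by norm_num) _).hasFDerivAt).comp y
      e.symm.hasFDerivAt)
  have hdiv : ∀ y, ∑ i, f' y (Pi.single i 1) i = divergence σ (WithLp.toLp 2 y) := fun y => rfl
  have hle : -r ≤ r := fun j => by
    have := hr j
    simp only [Pi.neg_apply]
    linarith
  have hcont : Continuous fun y => ∑ i, f' y (Pi.single i 1) i := by
    simp_rw [hdiv]
    exact (continuous_divergence hσ).comp e.symm.continuous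
  have hint : IntegrableOn (fun y => ∑ i, f' y (Pi.single i 1) i) (Set.Icc (-r) r) :=
    hcont.continuousOn.integrableOn_compact isCompact_Icc
  have h := integral_divergence_of_hasFDerivAt_off_countable (-r) r hle f f' ∅
    Set.countable_empty (fun y _ => (hf y).continuousAt.continuousWithinAt) (fun y _ => hf y) hint
  simp_rw [hdiv] at h
  rw [setIntegral_box, h, Finset.mul_sum]
  refine Finset.sum_le_sum fun j _ => ?_
  set S := Set.Icc ((-r) ∘ j.succAbove) (r ∘ j.succAbove) with hS
  have hvol : volume.real S = ∏ l, 2 * r (j.succAbove l) := by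
    rw [Measure.real, hS, Real.volume_Icc_pi_toReal
      (show (-r) ∘ j.succAbove ≤ r ∘ j.succAbove from fun l => hle _)]
    refine Finset.prod_congr rfl fun l _ => ?_
    simp only [Function.comp_apply, Pi.neg_apply]
    ring
  have hbound : ∀ c : ℝ, |∫ y in S, f (Fin.insertNth j c y) j| ≤
      F (EuclideanSpace.single j 1) * volume.real S := by
    intro c
    rw [← Real.norm_eq_abs]
    refine norm_setIntegral_le_of_norm_le_const ?_ fun y _ => ?_
    · exact isCompact_Icc.measure_lt_top
    · exact hF.abs_apply_le (hσp _) j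
  have h1 := (abs_le.1 (hbound (r j))).2
  have h2 := (abs_le.1 (hbound ((-r) j))).1
  have h3 : volume.real (box r) * (F (EuclideanSpace.single j 1) / r j) =
      2 * (F (EuclideanSpace.single j 1) * volume.real S) := by
    rw [volume_real_box hr, Fin.prod_univ_succAbove _ j, hvol]
    have := (hr j).ne'
    field_simp
  rw [h3]
  linarith

lemma IsAdmissible.cheegerConstant_box_le (hF : IsAdmissible p F) (hN : N ≠ 0)
    (hr : ∀ j, 0 < r j) : cheegerConstant F (box r) ≤
      ENNReal.ofReal (∑ j, F (EuclideanSpace.single j 1) / r j) := by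
  obtain ⟨n, rfl⟩ := Nat.exists_eq_succ_of_ne_zero hN
  have hfin : volume (box r) ≠ ⊤ := (isBounded_box r).measure_lt_top.ne
  have hpos : 0 < volume (box r) := (isOpen_box r).measure_pos _ ⟨0, zero_mem_box hr⟩
  refine (iInf₂_le_of_le (box r) (isOpen_box r).measurableSet
    (iInf₂_le_of_le subset_rfl hpos le_rfl)).trans ?_
  refine ENNReal.div_le_of_le_mul ?_
  refine iSup₂_le fun σ hσ => iSup₂_le fun _ hσp => ?_
  refine (ENNReal.ofReal_le_ofReal (hF.integral_divergence_box_le hr hσ hσp)).trans_eq ?_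
  rw [ENNReal.ofReal_mul measureReal_nonneg, Measure.real, ENNReal.ofReal_toReal hfin, mul_comm]

/-- Otherwise `Ω` and the complement of its closure would disconnect the segment. -/
lemma exists_mem_segment_frontier {Ω : Set (E N)} (hΩ : IsOpen Ω) {x z : E N} (hx : x ∈ Ω)
    (hz : z ∉ Ω) : ∃ y ∈ segment ℝ x z, y ∈ frontier Ω := by
  by_contra! h
  have hsub : segment ℝ x z ⊆ Ω ∪ (closure Ω)ᶜ := by
    intro y hy
    by_contra hyn
    simp only [Set.mem_union, Set.mem_compl_iff, not_or, not_not] at hyn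
    exact h y hy ⟨hyn.2, by rw [hΩ.interior_eq]; exact hyn.1⟩
  have hdisj : Disjoint Ω (closure Ω)ᶜ :=
    Set.disjoint_compl_right_iff_subset.2 subset_closure
  rcases (convex_segment x z).isPreconnected.subset_or_subset hΩ isClosed_closure.isOpen_compl
    hdisj hsub with h1 | h1
  · exact hz (h1 (right_mem_segment ℝ x z))
  · exact h1 (left_mem_segment ℝ x z) (subset_closure hx)

/-- The inradius of a box is at most its anisotropic half-width in each coordinate direction. -/
lemma IsAdmissible.inradius_box_le (hF : IsAdmissible p F) (hr : ∀ j, 0 < r j) (i : Fin N) :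
    inradius F (box r) ≤ r i / F (EuclideanSpace.single i 1) := by
  have he : EuclideanSpace.single i (1 : ℝ) ≠ 0 := by simp
  have hp := hF.pos he
  set c := F (EuclideanSpace.single i 1)
  -- The optimal direction towards the face: `F°(w) ≤ 1`, while its `i`-th coordinate is `F(e_i)`.
  set w := grad F (EuclideanSpace.single i 1)
  have hwi : w i = c := by
    have := hF.inner_grad_self he
    simpa [EuclideanSpace.inner_single_left] using this
  refine Real.iSup_le (fun x => ?_) (by have := hr i; positivity)
  obtain ⟨x, hx⟩ := x
  obtain ⟨θ, hθ, hθx⟩ : ∃ θ : ℝ, |θ| = 1 ∧ 0 ≤ θ * x i := by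
    rcases le_total 0 (x i) with h | h
    · exact ⟨1, by simp, by simpa using h⟩
    · exact ⟨-1, by simp, by linarith⟩
  have hθ2 : θ * θ = 1 := by
    rw [← abs_mul_abs_self, hθ, one_mul]
  have hlt : θ * x i < r i := by
    calc θ * x i ≤ |θ * x i| := le_abs_self _
      _ = |x i| := by rw [abs_mul, hθ, one_mul]
      _ < r i := hx i
  -- The time at which `x + t θ w` reaches the hyperplane of the nearer `i`-th face. The path may
  -- leave the box earlier through another face, which only shortens the distance.
  set t := (r i - θ * x i) / c with ht
  have ht0 : 0 ≤ t := div_nonneg (by linarith) hp.le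
  have htr : t ≤ r i / c := by
    rw [ht]
    gcongr
    linarith
  have hz : x + (t * θ) • w ∉ box r := by
    intro h
    have h1 := h i
    have h2 : θ * (x + (t * θ) • w) i = r i := by
      simp only [PiLp.add_apply, PiLp.smul_apply, smul_eq_mul, hwi]
      calc θ * (x i + t * θ * c) = θ * x i + (θ * θ) * (t * c) := by ring
        _ = r i := by
          rw [hθ2, ht, div_mul_cancel₀ _ hp.ne']
          ring
    have h3 : |θ * (x + (t * θ) • w) i| < r i := by
      rw [abs_mul, hθ, one_mul]
      exact h1
    rw [h2] at h3
    exact absurd (le_abs_self (r i)) (not_le.2 h3)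
  obtain ⟨y, hy, hyf⟩ := exists_mem_segment_frontier (isOpen_box r) hx hz
  rw [segment_eq_image'] at hy
  obtain ⟨τ, ⟨hτ0, hτ1⟩, rfl⟩ := hy
  refine (hF.distBoundary_le hyf x).trans ?_
  have hxy : x - (x + τ • (x + (t * θ) • w - x)) = (-(τ * (t * θ))) • w := by
    rw [add_sub_cancel_left, smul_smul, neg_smul]
    abel
  rw [hxy]
  refine (hF.polar_smul_le zero_le_one fun ξ => ?_).trans ?_
  · rw [one_mul]
    exact hF.inner_grad_le he ξ
  · rw [mul_one, abs_neg, abs_mul, abs_mul, hθ, mul_one, abs_of_nonneg hτ0, abs_of_nonneg ht0]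
    exact (mul_le_of_le_one_left ht0 hτ1).trans htr

theorem IsAdmissible.tendsto_cheegerConstant_mul_inradius [Nontrivial (E N)]
    (hF : IsAdmissible p F) (i : Fin N) {a : ℝ} (ha : 0 < a) :
    Tendsto (fun k : ℝ => cheegerConstant F (rectangle i a k) *
      ENNReal.ofReal (inradius F (rectangle i a k))) atTop (𝓝 1) := by
  have hp : 0 < F (EuclideanSpace.single i 1) := hF.pos (by simp)
  have hsum : Tendsto (fun k : ℝ => ∑ j, F (EuclideanSpace.single j 1) / (if j = i then a else k))
      atTop (𝓝 (∑ j, if j = i then F (EuclideanSpace.single j 1) / a else 0)) := by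
    refine tendsto_finsetSum _ fun j _ => ?_
    by_cases hj : j = i
    · simp [hj]
    · simpa [hj] using tendsto_const_nhds.div_atTop tendsto_id
  rw [Finset.sum_ite_eq' Finset.univ i, if_pos (Finset.mem_univ i)] at hsum
  have hlim := ENNReal.tendsto_ofReal (hsum.mul_const (a / F (EuclideanSpace.single i 1)))
  rw [div_mul_div_cancel₀ ha.ne', div_self hp.ne', ENNReal.ofReal_one] at hlim
  -- The product lies between `1`, by the lower bound for convex sets, and `(∑ F(e_j) / r_j) * (a /
  -- F(e_i))`, in which only the `i`-th term survives in the limit.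
  refine tendsto_of_tendsto_of_tendsto_of_le_of_le' tendsto_const_nhds hlim ?_ ?_
  · filter_upwards [eventually_gt_atTop 0] with k hk
    rw [rectangle_eq_box]
    set r : Fin N → ℝ := fun j => if j = i then a else k
    have hr : ∀ j, 0 < r j := fun j => by
      simp only [r]
      split_ifs <;> assumption
    have hne : (box r).Nonempty := ⟨0, zero_mem_box hr⟩
    have hR := hF.inradius_pos (isOpen_box r) (isBounded_box r) hne
    calc (1 : ℝ≥0∞) = 1 / ENNReal.ofReal (inradius F (box r)) *
          ENNReal.ofReal (inradius F (box r)) :=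
        (ENNReal.div_mul_cancel (ENNReal.ofReal_pos.2 hR).ne' ENNReal.ofReal_ne_top).symm
      _ ≤ _ := by
        gcongr
        exact hF.one_div_inradius_le_cheegerConstant (isOpen_box r) (convex_box r)
          (isBounded_box r) hne
  · filter_upwards [eventually_gt_atTop 0] with k hk
    rw [rectangle_eq_box]
    set r : Fin N → ℝ := fun j => if j = i then a else k
    have hr : ∀ j, 0 < r j := fun j => by
      simp only [r]
      split_ifs <;> assumption
    have h1 := hF.cheegerConstant_box_le i.pos.ne' hr
    have h2 := hF.inradius_box_le hr i
    rw [show r i = a from if_pos rfl] at h2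
    rw [ENNReal.ofReal_mul (Finset.sum_nonneg fun j _ => div_nonneg (hF.nonneg _) (hr j).le)]
    gcongr

end Box

end AnisotropicCheeger

theorem mainTheorem9 {N : ℕ} (hN : 2 ≤ N) {p : ℝ} (hp : 1 < p)
    {F : AnisotropicCheeger.E N → ℝ} (hF : AnisotropicCheeger.IsAdmissible p F) :
    (∀ Ω : Set (AnisotropicCheeger.E N), IsOpen Ω → Convex ℝ Ω → Bornology.IsBounded Ω →
      Ω.Nonempty →
        0 < AnisotropicCheeger.inradius F Ω ∧
        1 / ENNReal.ofReal (AnisotropicCheeger.inradius F Ω)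
          ≤ AnisotropicCheeger.cheegerConstant F Ω) ∧
    (∀ (i : Fin N) (a : ℝ), 0 < a →
      Tendsto (fun k : ℝ =>
          AnisotropicCheeger.cheegerConstant F (AnisotropicCheeger.rectangle i a k) *
            ENNReal.ofReal (AnisotropicCheeger.inradius F (AnisotropicCheeger.rectangle i a k)))
        atTop (𝓝 1)) := by
  have : Nonempty (Fin N) := ⟨⟨0, by omega⟩⟩
  have : Nontrivial (AnisotropicCheeger.E N) := inferInstance
  exact ⟨fun Ω hΩ hc hb hne => ⟨hF.inradius_pos hΩ hb hne,
    hF.one_div_inradius_le_cheegerConstant hΩ hc hb hne⟩,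
    fun i a ha => hF.tendsto_cheegerConstant_mul_inradius i ha⟩
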